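/- For integers $n,r\ge 0$ and $t\ge 1$ let $$S_n(\{1\}^r)=\sum_{1\le j_1\le\cdots\le j_r\le n}\frac{1}{j_1\cdots j_r},\qquad H_n^{(t)}=\sum_{j=1}^n\frac1{j^t},$$ with $S_n(\{1\}^0)=1$, and let $B_n$ be the $n$-th Bernoulli number. Let $r\ge 0$ be an integer and let $p$ be a prime with $p>r+3$. Then $$\sum_{k=1}^{p-1}\frac{\binom{2k}{k}}{k\,4^k}\,S_k(\{1\}^r)\equiv \begin{cases} -H^{(r+1)}_{(p-1)/2} & \text{if } r \text{ is even},\\[2mm] \dfrac{2^{r+2}-1}{2(r+2)}\,p\,B_{p-r-2} & \text{if } r \text{ is odd} \end{cases} \pmod{p^2},$$ where a congruence $a\equiv b\pmod{p^2}$ between rational numbers means that $a-b\in p^2\mathbb{Z}_p$, with $\mathbb{Z}_p$ the ring of $p$-adic integers. -/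

import Mathlib

/-- The generalized harmonic number `H_n^{(t)} = ∑_{j=1}^n 1 / j^t`. -/
def harmonicNumber (n t : ℕ) : ℚ :=
  ∑ j ∈ Finset.Icc 1 n, 1 / (j : ℚ) ^ t

/-- The non-strict multiple harmonic sum `S_n(t_1, …, t_r)`: the sum of
`1 / (j_1 ^ t_1 ⋯ j_r ^ t_r)` over all integers `1 ≤ j_1 ≤ ⋯ ≤ j_r ≤ n`.
For `r = 0` the only (empty) tuple contributes the empty product `1`. -/
def multipleHarmonicSum (n : ℕ) {r : ℕ} (t : Fin r → ℕ) : ℚ :=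
  ∑ j ∈ Fintype.piFinset (fun _ : Fin r => Finset.Icc 1 n) with (∀ a b, a ≤ b → j a ≤ j b),
    1 / ∏ i, (j i : ℚ) ^ t i

/-- The congruence `a ≡ b (mod p^m)` of rational numbers in the ring of `p`-adic integers:
`a - b` is `p ^ m` times a `p`-adic integer. -/
def PadicModEq (p : ℕ) [Fact p.Prime] (m : ℕ) (a b : ℚ) : Prop :=
  ∃ c : ℤ_[p], (a : ℚ_[p]) - (b : ℚ_[p]) = (p : ℚ_[p]) ^ m * (c : ℚ_[p])

/-! Put N = p - 1 = 2n and F_r(a) = ∑_{k=1}^N (a)_k S_k({1}^r) / (k k!). Since binom(2k,k)/4^k =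
(1/2)_k/k!, the sum in question is F_r(1/2). The integers -n and n + 1 are 1/2 ∓ p/2, so first-order
terms cancel and 2 F_r(1/2) ≡ F_r(-n) + F_r(n+1) mod p^2.

At integers F_r is summed from its differences D_r(a) = F_r(a+1) - F_r(a), which satisfy a
D_{r+1}(a) + D_r(a) = (a+1)_N/N! · S_N({1}^{r+1}) (`mul_risingSumDiff_succ`). For -N ≤ a ≤ -1 the
right side vanishes, whence F_r(-n) = -H_n^{(r+1)} exactly. For 1 ≤ a ≤ n it is a product of two
multiples of p when r + 2 < p, whence `risingSum_modEq`.

What remains are relations mod p^2 between H_{p-1}^{(r+1)}, H_n^{(r+1)} and p H_n^{(r+2)}, from j ↦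
p - j. Even r needs only these; odd r also uses H_{p-1}^{(m)} ≡ m/(m+1) · p B_{p-1-m}. -/

/-- The non-strict multiple harmonic sum `S_n({1}^r)`. -/
def onesHarmonicSum (n r : ℕ) : ℚ :=
  multipleHarmonicSum n (fun _ : Fin r => 1)

/-! ### Recursions for harmonic sums and Newton's identities -/

theorem onesHarmonicSum_zero_right (n : ℕ) : onesHarmonicSum n 0 = 1 := by
  simp [onesHarmonicSum, multipleHarmonicSum]

theorem onesHarmonicSum_zero_left (r : ℕ) : onesHarmonicSum 0 (r + 1) = 0 := by
  unfold onesHarmonicSum multipleHarmonicSum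
  refine Finset.sum_eq_zero fun j hj => ?_
  rw [Finset.mem_filter, Fintype.mem_piFinset] at hj
  simpa using hj.1 0

theorem onesHarmonicSum_succ_succ (n r : ℕ) :
    onesHarmonicSum (n + 1) (r + 1) =
      onesHarmonicSum n (r + 1) + onesHarmonicSum (n + 1) r / ((n : ℚ) + 1) := by
  unfold onesHarmonicSum multipleHarmonicSum
  rw [← Finset.sum_filter_add_sum_filter_not _ (fun j : Fin (r + 1) → ℕ => j (Fin.last r) ≤ n)]
  congr 1
  · refine Finset.sum_congr ?_ fun _ _ => rfl
    ext j
    simp only [Finset.mem_filter, Fintype.mem_piFinset, Finset.mem_Icc]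
    constructor
    · rintro ⟨⟨h1, h2⟩, h3⟩
      exact ⟨fun a => ⟨(h1 a).1, (h2 a _ (Fin.le_last a)).trans h3⟩, h2⟩
    · rintro ⟨h1, h2⟩
      exact ⟨⟨fun a => ⟨(h1 a).1, (h1 a).2.trans n.le_succ⟩, h2⟩, (h1 _).2⟩
  -- The remaining tuples have largest entry exactly n + 1; dropping it leaves an r-tuple.
  · rw [Finset.sum_div]
    refine Finset.sum_bij' (fun j _ => Fin.init j)
      (fun j _ => Fin.snoc (α := fun _ => ℕ) j (n + 1)) ?_ ?_ ?_ ?_ ?_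
    · intro j hj
      simp only [Finset.mem_filter, Fintype.mem_piFinset, Finset.mem_Icc, Fin.init] at hj ⊢
      exact ⟨fun a => hj.1.1 _, fun a b hab => hj.1.2 _ _ (by simpa using hab)⟩
    · intro j hj
      simp only [Finset.mem_filter, Fintype.mem_piFinset, Finset.mem_Icc] at hj ⊢
      refine ⟨⟨fun a => ?_, fun a b hab => ?_⟩, by simp⟩
      · refine Fin.lastCases ?_ (fun i => ?_) a
        · simp
        · simpa using hj.1 i
      · induction b using Fin.lastCases with
        | last =>
          induction a using Fin.lastCases with
          | last => simp
          | cast a => simpa using (hj.1 a).2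
        | cast b =>
          induction a using Fin.lastCases with
          | last => exact absurd hab (by simp [Fin.le_def])
          | cast a => simpa using hj.2 a b (by simpa using hab)
    · intro j hj
      simp only [Finset.mem_filter, Fintype.mem_piFinset, Finset.mem_Icc] at hj
      have : j (Fin.last r) = n + 1 := by
        have := (hj.1.1 (Fin.last r)).2
        omega
      rw [← this, Fin.snoc_init_self]
    · intro j _
      simp
    · intro j hj
      simp only [Finset.mem_filter, Fintype.mem_piFinset, Finset.mem_Icc] at hj
      have : j (Fin.last r) = n + 1 := by
        have := (hj.1.1 (Fin.last r)).2
        omega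
      simp only [pow_one, Fin.prod_univ_castSucc, this, Fin.init]
      push_cast
      rw [div_div]

theorem harmonicNumber_succ (n t : ℕ) :
    harmonicNumber (n + 1) t = harmonicNumber n t + 1 / ((n : ℚ) + 1) ^ t := by
  unfold harmonicNumber
  rw [Finset.sum_Icc_succ_top (by omega)]
  push_cast
  rfl

section PowerSeriesIdentities

open PowerSeries

/-- **Newton's identities** for the complete homogeneous sums `S_n({1}^r)`. -/
theorem succ_mul_onesHarmonicSum_succ (n m : ℕ) :
    ((m : ℚ) + 1) * onesHarmonicSum n (m + 1) =
      ∑ i ∈ Finset.range (m + 1), harmonicNumber n (i + 1) * onesHarmonicSum n (m - i) := by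
  -- The generating function is ∏_{j≤n} 1/(1 - X/j); this is its logarithmic derivative.
  have key : ∀ n : ℕ, d⁄dX ℚ (PowerSeries.mk (onesHarmonicSum n)) =
      PowerSeries.mk (fun i => harmonicNumber n (i + 1)) *
        PowerSeries.mk (onesHarmonicSum n) := by
    intro n
    induction n with
    | zero =>
      ext m
      rw [PowerSeries.coeff_derivative, PowerSeries.coeff_mul]
      simp [onesHarmonicSum_zero_left, harmonicNumber]
    | succ n ih =>
      set x : ℚ := 1 / ((n : ℚ) + 1) with hx
      have h1 : (1 - C x * X) * PowerSeries.mk (onesHarmonicSum (n + 1)) =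
          PowerSeries.mk (onesHarmonicSum n) := by
        ext m
        rw [sub_mul, one_mul, mul_assoc, map_sub, PowerSeries.coeff_C_mul]
        cases m with
        | zero => simp [onesHarmonicSum_zero_right]
        | succ m =>
          rw [PowerSeries.coeff_succ_X_mul, coeff_mk, coeff_mk, coeff_mk,
            onesHarmonicSum_succ_succ, hx]
          ring
      have h2 : (1 - C x * X) * (PowerSeries.mk (fun i => harmonicNumber (n + 1) (i + 1)) -
          PowerSeries.mk (fun i => harmonicNumber n (i + 1))) = C x := by
        ext m
        rw [sub_mul, one_mul, mul_assoc, map_sub, PowerSeries.coeff_C_mul]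
        cases m with
        | zero => simp [harmonicNumber_succ, hx]
        | succ m =>
          rw [PowerSeries.coeff_succ_X_mul, map_sub, map_sub, coeff_mk, coeff_mk, coeff_mk,
            coeff_mk, coeff_C, if_neg (by omega), harmonicNumber_succ, harmonicNumber_succ, hx]
          have : (n : ℚ) + 1 ≠ 0 := by positivity
          field_simp
          ring
      have h3 := congrArg (d⁄dX ℚ) h1
      rw [Derivation.leibniz, smul_eq_mul, smul_eq_mul, ih] at h3
      have h4 : d⁄dX ℚ (1 - C x * X) = - C x := by
        rw [map_sub, Derivation.leibniz]
        simp
      rw [h4] at h3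
      have hne : (1 - C x * X : PowerSeries ℚ) ≠ 0 := by
        intro h
        have := congrArg (PowerSeries.coeff 0) h
        simp at this
      apply mul_left_cancel₀ hne
      linear_combination h3 - PowerSeries.mk (onesHarmonicSum (n + 1)) * h2 -
        PowerSeries.mk (fun i => harmonicNumber n (i + 1)) * h1
  have := congrArg (PowerSeries.coeff m) (key n)
  rw [PowerSeries.coeff_derivative, PowerSeries.coeff_mul,
    Finset.Nat.sum_antidiagonal_eq_sum_range_succ_mk] at this
  simp only [coeff_mk] at this
  rw [← this]
  ring

end PowerSeriesIdentities

/-! ### Rising-factorial sums and their values at integers -/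

/-- The rising factorial `a (a + 1) ⋯ (a + k - 1)`. -/
def risingFactorial (a : ℚ) (k : ℕ) : ℚ :=
  ∏ i ∈ Finset.range k, (a + i)

theorem risingFactorial_zero (a : ℚ) : risingFactorial a 0 = 1 := by
  simp [risingFactorial]

theorem risingFactorial_succ (a : ℚ) (k : ℕ) :
    risingFactorial a (k + 1) = risingFactorial a k * (a + k) := by
  rw [risingFactorial, Finset.prod_range_succ, risingFactorial]

theorem risingFactorial_succ' (a : ℚ) (k : ℕ) :
    risingFactorial a (k + 1) = a * risingFactorial (a + 1) k := by
  rw [risingFactorial, Finset.prod_range_succ', risingFactorial, mul_comm, Nat.cast_zero,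
    add_zero]
  refine congrArg _ (Finset.prod_congr rfl fun i _ => ?_)
  push_cast
  ring

theorem risingFactorial_half (k : ℕ) :
    risingFactorial (1 / 2) k = k.factorial * (((2 * k).choose k : ℚ) / 4 ^ k) := by
  induction k with
  | zero => simp [risingFactorial_zero]
  | succ k ih =>
    have h : ((k : ℚ) + 1) * ((2 * (k + 1)).choose (k + 1) : ℚ) =
        2 * (2 * k + 1) * ((2 * k).choose k : ℚ) := by
      exact_mod_cast Nat.succ_mul_centralBinom_succ k
    rw [risingFactorial_succ, ih, Nat.factorial_succ, pow_succ]
    push_cast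
    field_simp
    linear_combination -2 * h

/-- The sum `∑_{k=1}^N (a)_k S_k({1}^r) / (k k!)`. -/
def risingSum (N r : ℕ) (a : ℚ) : ℚ :=
  ∑ k ∈ Finset.range N,
    risingFactorial a (k + 1) / (((k : ℚ) + 1) * (k + 1).factorial) * onesHarmonicSum (k + 1) r

/-- The difference `risingSum N r (a + 1) - risingSum N r a`. -/
def risingSumDiff (N r : ℕ) (a : ℚ) : ℚ :=
  ∑ k ∈ Finset.range N,
    risingFactorial (a + 1) k / (k + 1).factorial * onesHarmonicSum (k + 1) r

/-- (a+1)_{k+1} - (a)_{k+1} = (k+1)(a+1)_k, which cancels the factor k + 1 in the denominator. -/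
theorem risingSum_add_one (N r : ℕ) (a : ℚ) :
    risingSum N r (a + 1) = risingSum N r a + risingSumDiff N r a := by
  unfold risingSum risingSumDiff
  rw [← Finset.sum_add_distrib]
  refine Finset.sum_congr rfl fun k _ => ?_
  rw [risingFactorial_succ, risingFactorial_succ']
  have : ((k + 1).factorial : ℚ) ≠ 0 := mod_cast Nat.factorial_ne_zero _
  field_simp
  ring

theorem risingSum_zero (N r : ℕ) : risingSum N r 0 = 0 := by
  simp [risingSum, risingFactorial_succ']

theorem risingSumDiff_zero_right (N r : ℕ) :
    risingSumDiff N r 0 = onesHarmonicSum N (r + 1) := by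
  induction N with
  | zero => simp [risingSumDiff, onesHarmonicSum_zero_left]
  | succ N ih =>
    have h : risingFactorial (0 + 1) N = N.factorial := by
      clear ih
      induction N with
      | zero => simp [risingFactorial_zero]
      | succ N ih =>
        rw [risingFactorial_succ, ih, Nat.factorial_succ]
        push_cast
        ring
    rw [onesHarmonicSum_succ_succ, ← ih, risingSumDiff, Finset.sum_range_succ, h,
      Nat.factorial_succ, ← risingSumDiff]
    have : (N.factorial : ℚ) ≠ 0 := mod_cast Nat.factorial_ne_zero _
    push_cast
    field_simp

theorem mul_risingSumDiff_zero (N : ℕ) (a : ℚ) :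
    a * risingSumDiff N 0 a = risingFactorial (a + 1) N / N.factorial - 1 := by
  induction N with
  | zero => simp [risingSumDiff, risingFactorial_zero]
  | succ N ih =>
    rw [risingSumDiff, Finset.sum_range_succ, ← risingSumDiff, mul_add, ih,
      onesHarmonicSum_zero_right, risingFactorial_succ, Nat.factorial_succ]
    have : (N.factorial : ℚ) ≠ 0 := mod_cast Nat.factorial_ne_zero _
    push_cast
    field_simp
    ring

/-- Lowers the depth r: divided by a, it determines every difference from depth 0. It holds by
telescoping in N. -/
theorem mul_risingSumDiff_succ (N r : ℕ) (a : ℚ) :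
    a * risingSumDiff N (r + 1) a + risingSumDiff N r a =
      risingFactorial (a + 1) N / N.factorial * onesHarmonicSum N (r + 1) := by
  induction N with
  | zero => simp [risingSumDiff, onesHarmonicSum_zero_left]
  | succ N ih =>
    have e : ∀ s, risingSumDiff (N + 1) s a = risingSumDiff N s a +
        risingFactorial (a + 1) N / (N + 1).factorial * onesHarmonicSum (N + 1) s := fun s => by
      rw [risingSumDiff, Finset.sum_range_succ, ← risingSumDiff]
    have hr : onesHarmonicSum N (r + 1) = onesHarmonicSum (N + 1) (r + 1) -
        onesHarmonicSum (N + 1) r / ((N : ℚ) + 1) := by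
      rw [onesHarmonicSum_succ_succ]; ring
    rw [hr] at ih
    rw [e, e, risingFactorial_succ]
    rw [Nat.factorial_succ]
    have : (N.factorial : ℚ) ≠ 0 := mod_cast Nat.factorial_ne_zero _
    push_cast
    field_simp
    field_simp at ih
    linear_combination ih

theorem risingFactorial_neg_add_one (N j : ℕ) (h0 : j < N) :
    risingFactorial (-((j : ℚ) + 1) + 1) N = 0 := by
  refine Finset.prod_eq_zero (Finset.mem_range.2 h0) ?_
  ring

/-- The factor (a+1)_N contains 0, so the depth recursion is just division by -a = j + 1. -/
theorem risingSumDiff_neg (N j r : ℕ) (h0 : j < N) :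
    risingSumDiff N r (-((j : ℚ) + 1)) = 1 / ((j : ℚ) + 1) ^ (r + 1) := by
  have hj : (j : ℚ) + 1 ≠ 0 := by positivity
  induction r with
  | zero =>
    have h := mul_risingSumDiff_zero N (-((j : ℚ) + 1))
    rw [risingFactorial_neg_add_one N j h0] at h
    field_simp
    linear_combination -h
  | succ r ih =>
    have h := mul_risingSumDiff_succ N r (-((j : ℚ) + 1))
    rw [risingFactorial_neg_add_one N j h0, ih] at h
    rw [zero_div, zero_mul] at h
    rw [pow_succ]
    field_simp at h ⊢
    linear_combination -h

theorem risingSum_neg (N n r : ℕ) (hn : n ≤ N) :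
    risingSum N r (-(n : ℚ)) = -harmonicNumber n (r + 1) := by
  induction n with
  | zero => simp [risingSum_zero, harmonicNumber]
  | succ n ih =>
    have h := risingSum_add_one N r (-((n : ℚ) + 1))
    rw [risingSumDiff_neg N n r (by omega), show -((n : ℚ) + 1) + 1 = -(n : ℚ) by ring,
      ih (by omega)] at h
    rw [harmonicNumber_succ]
    push_cast
    linear_combination -h

/-- Telescoping from F(0) = 0; the step at 0 is separated because the depth recursion cannot be
divided by a = 0. -/
theorem risingSum_natCast (N n r : ℕ) :
    risingSum N r ((n : ℚ) + 1) = onesHarmonicSum N (r + 1) +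
      ∑ a ∈ Finset.range n, risingSumDiff N r ((a : ℚ) + 1) := by
  induction n with
  | zero =>
    have h := risingSum_add_one N r 0
    rw [risingSum_zero, risingSumDiff_zero_right] at h
    simpa using h
  | succ n ih =>
    rw [Finset.sum_range_succ]
    push_cast
    rw [risingSum_add_one, ih]
    ring

/-! ### Congruences between p-integral rationals -/

/-- The subring of `p`-integral rational numbers. -/
noncomputable def padicIntegral (p : ℕ) [Fact p.Prime] : Subring ℚ :=
  (PadicInt.subring p).comap (Rat.castHom ℚ_[p])

/-- The congruence `a ≡ b (mod p^m)` expressed with `p`-integral rational numbers. -/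
def IntegralModEq (p : ℕ) [Fact p.Prime] (m : ℕ) (a b : ℚ) : Prop :=
  ∃ c ∈ padicIntegral p, a - b = (p : ℚ) ^ m * c

section Integrality

variable {p : ℕ} [Fact p.Prime]

theorem IntegralModEq.padicModEq {m : ℕ} {a b : ℚ} (h : IntegralModEq p m a b) :
    PadicModEq p m a b := by
  obtain ⟨c, hc, h⟩ := h
  refine ⟨⟨(c : ℚ_[p]), hc⟩, ?_⟩
  have := congrArg (fun x : ℚ => (x : ℚ_[p])) h
  simpa using this

theorem inv_natCast_mem_padicIntegral {k : ℕ} (hk : ¬ p ∣ k) : (k : ℚ)⁻¹ ∈ padicIntegral p := by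
  change ‖(((k : ℚ)⁻¹ : ℚ) : ℚ_[p])‖ ≤ 1
  have : ‖(k : ℚ_[p])‖ = 1 :=
    Padic.norm_natCast_eq_one_iff.2 ((Nat.Prime.coprime_iff_not_dvd Fact.out).2 hk)
  simp [this]

theorem inv_natCast_mem_of_lt {k : ℕ} (h0 : 0 < k) (hk : k < p) :
    (k : ℚ)⁻¹ ∈ padicIntegral p :=
  inv_natCast_mem_padicIntegral (Nat.not_dvd_of_pos_of_lt h0 hk)

theorem inv_factorial_mem_of_lt {k : ℕ} (hk : k < p) :
    (k.factorial : ℚ)⁻¹ ∈ padicIntegral p := by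
  refine inv_natCast_mem_padicIntegral fun h => ?_
  exact absurd ((Nat.Prime.dvd_factorial Fact.out).1 h) (by omega)

theorem div_natCast_mem_of_lt {x : ℚ} (hx : x ∈ padicIntegral p) {k : ℕ} (h0 : 0 < k)
    (hk : k < p) : x / (k : ℚ) ∈ padicIntegral p := by
  rw [div_eq_mul_inv]
  exact mul_mem hx (inv_natCast_mem_of_lt h0 hk)

namespace IntegralModEq

variable {m : ℕ} {a b c d : ℚ}

theorem of_eq (h : a = b) : IntegralModEq p m a b := ⟨0, zero_mem _, by simp [h]⟩

theorem refl (a : ℚ) : IntegralModEq p m a a := of_eq rfl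

theorem symm (h : IntegralModEq p m a b) : IntegralModEq p m b a := by
  obtain ⟨x, hx, h⟩ := h
  exact ⟨-x, neg_mem hx, by linear_combination -h⟩

theorem trans (h : IntegralModEq p m a b) (h' : IntegralModEq p m b c) :
    IntegralModEq p m a c := by
  obtain ⟨x, hx, h⟩ := h
  obtain ⟨y, hy, h'⟩ := h'
  exact ⟨x + y, add_mem hx hy, by linear_combination h + h'⟩

theorem add (h : IntegralModEq p m a b) (h' : IntegralModEq p m c d) :
    IntegralModEq p m (a + c) (b + d) := by
  obtain ⟨x, hx, h⟩ := h
  obtain ⟨y, hy, h'⟩ := h'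
  exact ⟨x + y, add_mem hx hy, by linear_combination h + h'⟩

theorem sub (h : IntegralModEq p m a b) (h' : IntegralModEq p m c d) :
    IntegralModEq p m (a - c) (b - d) := by
  obtain ⟨x, hx, h⟩ := h
  obtain ⟨y, hy, h'⟩ := h'
  exact ⟨x - y, sub_mem hx hy, by linear_combination h - h'⟩

theorem mul_left (hc : c ∈ padicIntegral p) (h : IntegralModEq p m a b) :
    IntegralModEq p m (c * a) (c * b) := by
  obtain ⟨x, hx, h⟩ := h
  exact ⟨c * x, mul_mem hc hx, by linear_combination c * h⟩

theorem mul (hb : b ∈ padicIntegral p) (hc : c ∈ padicIntegral p)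
    (h : IntegralModEq p m a b) (h' : IntegralModEq p m c d) :
    IntegralModEq p m (a * c) (b * d) := by
  obtain ⟨x, hx, h⟩ := h
  obtain ⟨y, hy, h'⟩ := h'
  exact ⟨x * c + b * y, add_mem (mul_mem hx hc) (mul_mem hb hy),
    by linear_combination c * h + b * h'⟩

theorem sum {ι : Type*} {s : Finset ι} {f g : ι → ℚ}
    (h : ∀ i ∈ s, IntegralModEq p m (f i) (g i)) :
    IntegralModEq p m (∑ i ∈ s, f i) (∑ i ∈ s, g i) := by
  classical
  induction s using Finset.induction_on with
  | empty => exact refl _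
  | insert i s hi ih =>
    rw [Finset.sum_insert hi, Finset.sum_insert hi]
    exact (h i (Finset.mem_insert_self _ _)).add
      (ih fun j hj => h j (Finset.mem_insert_of_mem hj))

/-- If `a, c ≡ 0 (mod p)` then `a c ≡ 0 (mod p^2)`. -/
theorem mul_zero_zero (h : IntegralModEq p 1 a 0) (h' : IntegralModEq p 1 c 0) :
    IntegralModEq p 2 (a * c) 0 := by
  obtain ⟨x, hx, h⟩ := h
  obtain ⟨y, hy, h'⟩ := h'
  exact ⟨x * y, mul_mem hx hy, by linear_combination c * h + p * x * h'⟩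

theorem prime_mul (h : IntegralModEq p 1 a b) : IntegralModEq p 2 (p * a) (p * b) := by
  obtain ⟨x, hx, h⟩ := h
  exact ⟨x, hx, by linear_combination p * h⟩

theorem of_two (h : IntegralModEq p 2 a b) : IntegralModEq p 1 a b := by
  obtain ⟨x, hx, h⟩ := h
  exact ⟨p * x, mul_mem (natCast_mem _ _) hx, by linear_combination h⟩

theorem prime_mul_zero (h : a ∈ padicIntegral p) : IntegralModEq p 1 (p * a) 0 :=
  ⟨a, h, by ring⟩

theorem intCast_of_dvd {x : ℤ} (h : (p : ℤ) ^ m ∣ x) : IntegralModEq p m x 0 := by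
  obtain ⟨y, rfl⟩ := h
  exact ⟨y, intCast_mem _ _, by push_cast; ring⟩

end IntegralModEq

theorem risingFactorial_mem {a : ℚ} (ha : a ∈ padicIntegral p) (k : ℕ) :
    risingFactorial a k ∈ padicIntegral p :=
  prod_mem fun _ _ => add_mem ha (natCast_mem _ _)

theorem onesHarmonicSum_mem (r : ℕ) {n : ℕ} (hn : n < p) :
    onesHarmonicSum n r ∈ padicIntegral p := by
  induction r generalizing n with
  | zero => rw [onesHarmonicSum_zero_right]; exact one_mem _
  | succ r ihr =>
    induction n with
    | zero => rw [onesHarmonicSum_zero_left]; exact zero_mem _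
    | succ n ihn =>
      rw [onesHarmonicSum_succ_succ]
      have := div_natCast_mem_of_lt (ihr hn) n.succ_pos hn
      push_cast at this
      exact add_mem (ihn (by omega)) this

/-- First-order expansion of the rising factorial. -/
theorem exists_risingFactorial_add_modEq {x : ℚ} (hx : x ∈ padicIntegral p) (k : ℕ) :
    ∃ D ∈ padicIntegral p, ∀ d ∈ padicIntegral p,
      IntegralModEq p 2 (risingFactorial (x + p * d) k) (risingFactorial x k + p * d * D) := by
  induction k with
  | zero => exact ⟨0, zero_mem _, fun d _ => .of_eq (by simp [risingFactorial_zero])⟩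
  | succ k ih =>
    obtain ⟨D, hD, h⟩ := ih
    have hxk : x + k ∈ padicIntegral p := add_mem hx (natCast_mem _ _)
    refine ⟨D * (x + k) + risingFactorial x k,
      add_mem (mul_mem hD hxk) (risingFactorial_mem hx k), fun d hd => ?_⟩
    obtain ⟨c, hc, h⟩ := h d hd
    -- The term d²D is the second-order product of p·d·D with the p·d in the new factor.
    refine ⟨c * (x + p * d + k) + d * d * D, add_mem (mul_mem hc (add_mem (add_mem hx
      (mul_mem (natCast_mem _ _) hd)) (natCast_mem _ _))) (mul_mem (mul_mem hd hd) hD), ?_⟩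
    rw [risingFactorial_succ, risingFactorial_succ]
    linear_combination (x + p * d + k) * h

theorem sum_Icc_one_eq_sum_range (N : ℕ) (f : ℕ → ℚ) :
    ∑ k ∈ Finset.Icc 1 N, f k = ∑ k ∈ Finset.range N, f (k + 1) := by
  induction N with
  | zero => simp
  | succ N ih => rw [Finset.sum_Icc_succ_top (by omega), ih, Finset.sum_range_succ]

theorem harmonicNumber_eq_sum_range (n t : ℕ) :
    harmonicNumber n t = ∑ j ∈ Finset.range n, 1 / (((j + 1 : ℕ) : ℚ)) ^ t :=
  sum_Icc_one_eq_sum_range _ _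

/-- The coefficient D of the expansion at 1/2 does not depend on the displacement, so the
displacements ±p/2 cancel to first order. -/
theorem two_mul_sum_centralBinom_modEq {n : ℕ} (hp : p = 2 * n + 1) (r : ℕ) :
    IntegralModEq p 2
      (2 * ∑ k ∈ Finset.Icc 1 (p - 1),
        ((2 * k).choose k : ℚ) / ((k : ℚ) * 4 ^ k) * onesHarmonicSum k r)
      (risingSum (p - 1) r (-(n : ℚ)) + risingSum (p - 1) r ((n : ℚ) + 1)) := by
  have hp2 := (Fact.out : p.Prime).two_le
  have h2 : (1 / 2 : ℚ) ∈ padicIntegral p := by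
    have := inv_natCast_mem_of_lt (p := p) (k := 2) (by omega) (by omega)
    simpa using this
  rw [sum_Icc_one_eq_sum_range, risingSum, risingSum, ← Finset.sum_add_distrib, Finset.mul_sum]
  refine .sum fun k hk => ?_
  rw [Finset.mem_range] at hk
  obtain ⟨D, hD, h⟩ := exists_risingFactorial_add_modEq h2 (k + 1)
  have hA := (h (1 / 2) h2).add (h (-(1 / 2)) (neg_mem h2))
  have e1 : (1 / 2 : ℚ) + p * (1 / 2) = n + 1 := by rw [hp]; push_cast; ring
  have e2 : (1 / 2 : ℚ) + p * (-(1 / 2)) = -n := by rw [hp]; push_cast; ring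
  rw [e1, e2, risingFactorial_half] at hA
  have hc : (((k + 1 : ℕ) : ℚ)⁻¹ * ((k + 1).factorial : ℚ)⁻¹ * onesHarmonicSum (k + 1) r) ∈
      padicIntegral p :=
    mul_mem (mul_mem (inv_natCast_mem_of_lt (by omega) (by omega))
      (inv_factorial_mem_of_lt (by omega))) (onesHarmonicSum_mem r (by omega))
  have hf : ((k + 1).factorial : ℚ) ≠ 0 := mod_cast Nat.factorial_ne_zero _
  refine ((IntegralModEq.of_eq ?_).trans (hA.symm.mul_left hc)).trans (IntegralModEq.of_eq ?_)
  · push_cast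
    field_simp
    ring
  · push_cast
    field_simp
    ring

theorem risingFactorial_one (N : ℕ) : risingFactorial 1 N = N.factorial := by
  induction N with
  | zero => simp [risingFactorial_zero]
  | succ N ih =>
    rw [risingFactorial_succ, ih, Nat.factorial_succ]
    push_cast
    ring

/-- The quotient is binom(p+a, a+1): it equals p at a = 0, and passing from a to a + 1 multiplies it
by (a+1+p)/(a+2). -/
theorem risingFactorial_div_factorial_modEq (a : ℕ) (ha : a + 1 < p) :
    IntegralModEq p 2 (risingFactorial ((a : ℚ) + 1 + 1) (p - 1) / (p - 1).factorial)
      (p / ((a : ℚ) + 1)) := by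
  have hp1 : ((p - 1 : ℕ) : ℚ) = p - 1 := by
    rw [Nat.cast_sub (by omega)]; simp
  have hf : ((p - 1).factorial : ℚ) ≠ 0 := mod_cast Nat.factorial_ne_zero _
  induction a with
  | zero =>
    refine .of_eq ?_
    have h := risingFactorial_succ' 1 (p - 1)
    rw [risingFactorial_one, Nat.factorial_succ] at h
    push_cast [hp1] at h ⊢
    field_simp
    rw [zero_add]
    linear_combination -h
  | succ a ih =>
    obtain ⟨c, hc, ih⟩ := ih (by omega)
    have h1 : ((a + 1 : ℕ) : ℚ)⁻¹ ∈ padicIntegral p := inv_natCast_mem_of_lt (by omega) (by omega)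
    have h2 : ((a + 2 : ℕ) : ℚ)⁻¹ ∈ padicIntegral p := inv_natCast_mem_of_lt (by omega) (by omega)
    push_cast at h1 h2
    have h := (risingFactorial_succ' ((a : ℚ) + 1 + 1) (p - 1)).symm.trans
      (risingFactorial_succ ((a : ℚ) + 1 + 1) (p - 1))
    rw [hp1] at h
    have e : ((a : ℚ) + 1 + 1) = a + 2 := by ring
    refine ⟨((a : ℚ) + 2)⁻¹ * (c * (a + 1 + p) + ((a : ℚ) + 1)⁻¹), ?_, ?_⟩
    · refine mul_mem h2 (add_mem (mul_mem hc ?_) h1)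
      exact_mod_cast natCast_mem (padicIntegral p) (a + 1 + p)
    · push_cast
      rw [e] at h ih ⊢
      have h3 : risingFactorial ((a : ℚ) + 2 + 1) (p - 1) =
          ((a : ℚ) + 2)⁻¹ * (risingFactorial ((a : ℚ) + 2) (p - 1) * (a + 1 + p)) := by
        field_simp
        linear_combination h
      rw [h3]
      have : ((a : ℚ) + 2) ≠ 0 := by positivity
      have : ((a : ℚ) + 1) ≠ 0 := by positivity
      have ih' : risingFactorial ((a : ℚ) + 2) (p - 1) =
          (p - 1).factorial * (p / (a + 1) + p ^ 2 * c) := by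
        rw [← ih]; field_simp; ring
      rw [ih']
      field_simp
      ring

end Integrality

/-! ### Power sums, Bernoulli numbers and full harmonic sums -/

theorem zmod_natCast_pow_prime_eq {p a b : ℕ} (h : a ≡ b [MOD p]) :
    (a : ZMod (p ^ 2)) ^ p = (b : ZMod (p ^ 2)) ^ p := by
  have h1 : (p : ℤ) ∣ (a : ℤ) - b := by
    have := (Nat.modEq_iff_dvd.1 h.symm)
    exact this
  have h2 := dvd_sub_pow_of_dvd_sub h1 1
  have h3 : (((a : ℤ) ^ p - (b : ℤ) ^ p : ℤ) : ZMod (p ^ 2)) = 0 := by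
    rw [ZMod.intCast_zmod_eq_zero_iff_dvd]
    simpa using h2
  push_cast at h3
  exact sub_eq_zero.1 h3

theorem exists_one_add_pow_eq (x f : ℤ) (e : ℕ) :
    ∃ c : ℤ, (1 + x * f) ^ e = 1 + e * x * f + x ^ 2 * c := by
  induction e with
  | zero => exact ⟨0, by simp⟩
  | succ e ih =>
    obtain ⟨c, hc⟩ := ih
    refine ⟨c * (1 + x * f) + e * f ^ 2, ?_⟩
    rw [pow_succ, hc]
    push_cast
    ring

section PowerSums

variable {p : ℕ} [Fact p.Prime]

/-- The recurrence for B_i divides only by i + 1, which is prime to p. -/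
theorem bernoulli_mem {i : ℕ} (hi : i + 1 < p) : bernoulli i ∈ padicIntegral p := by
  induction i using Nat.strong_induction_on with
  | _ i ih =>
    have h := sum_bernoulli (i + 1)
    rw [Finset.sum_range_succ, Nat.choose_succ_self_right] at h
    have e : bernoulli i = ((if i + 1 = 1 then 1 else 0) -
        ∑ k ∈ Finset.range i, ((i + 1).choose k : ℚ) * bernoulli k) / ((i + 1 : ℕ) : ℚ) := by
      rw [eq_div_iff (by positivity)]
      linear_combination h
    rw [e]
    refine div_natCast_mem_of_lt (sub_mem ?_ (sum_mem fun k hk => ?_)) i.succ_pos hi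
    · split_ifs
      · exact one_mem _
      · exact zero_mem _
    · rw [Finset.mem_range] at hk
      exact mul_mem (natCast_mem _ _) (ih k hk (by omega))

/-- The power sum `∑_{j=1}^{p-1} j^e`. -/
def powerSum (p e : ℕ) : ℚ :=
  ∑ j ∈ Finset.range (p - 1), ((j + 1 : ℕ) : ℚ) ^ e

theorem powerSum_eq_sum_range {e : ℕ} (he : e ≠ 0) :
    powerSum p e = ∑ j ∈ Finset.range p, (j : ℚ) ^ e := by
  have hp := (Fact.out : p.Prime).two_le
  conv_rhs => rw [show p = p - 1 + 1 by omega, Finset.sum_range_succ']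
  simp [powerSum, he]

/-- In Faulhaber's formula the B_e term is p B_e and every other term carries at least p^2. -/
theorem powerSum_modEq_bernoulli {e : ℕ} (he : e ≠ 0) (hep : e + 1 < p) :
    IntegralModEq p 2 (powerSum p e) (p * bernoulli e) := by
  rw [powerSum_eq_sum_range he, sum_range_pow, Finset.sum_range_succ]
  refine ⟨∑ i ∈ Finset.range e, bernoulli i * ((e + 1).choose i : ℚ) * (p : ℚ) ^ (e - 1 - i) /
    ((e + 1 : ℕ) : ℚ), sum_mem fun i hi => ?_, ?_⟩
  · rw [Finset.mem_range] at hi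
    exact div_natCast_mem_of_lt (mul_mem (mul_mem (bernoulli_mem (by omega)) (natCast_mem _ _))
      (pow_mem (natCast_mem _ _) _)) e.succ_pos hep
  · rw [Finset.mul_sum, Nat.choose_succ_self_right, Nat.add_sub_cancel_left, pow_one, add_sub_assoc]
    have : (e : ℚ) + 1 ≠ 0 := by positivity
    have h0 : bernoulli e * ((e + 1 : ℕ) : ℚ) * p / (e + 1) - p * bernoulli e = 0 := by
      push_cast
      field_simp
      ring
    rw [h0, add_zero]
    refine Finset.sum_congr rfl fun i hi => ?_
    rw [Finset.mem_range] at hi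
    rw [show e + 1 - i = 2 + (e - 1 - i) by omega, pow_add]
    push_cast
    ring

theorem powerSum_modEq_zero {e : ℕ} (he : e ≠ 0) (hep : e + 1 < p) :
    IntegralModEq p 1 (powerSum p e) 0 :=
  (powerSum_modEq_bernoulli he hep).of_two.trans (.prime_mul_zero (bernoulli_mem hep))

theorem exists_pow_pred_eq {j : ℕ} (h0 : 0 < j) (hj : j < p) :
    ∃ f : ℤ, (j : ℤ) ^ (p - 1) = 1 + p * f := by
  have hc : IsCoprime (j : ℤ) p := by
    rw [Nat.isCoprime_iff_coprime]
    exact ((Nat.Prime.coprime_iff_not_dvd Fact.out).2 (Nat.not_dvd_of_pos_of_lt h0 hj)).symm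
  obtain ⟨f, hf⟩ := (Int.ModEq.pow_card_sub_one_eq_one Fact.out hc).symm.dvd
  exact ⟨f, by linear_combination hf⟩

/-- By Fermat, j^{-m} ≡ j^{p-1-m} mod p. -/
theorem harmonicNumber_modEq_zero {m : ℕ} (hm : m ≠ 0) (hmp : m + 1 < p) :
    IntegralModEq p 1 (harmonicNumber (p - 1) m) 0 := by
  refine IntegralModEq.trans ?_ (powerSum_modEq_zero (e := p - 1 - m) (by omega) (by omega))
  rw [harmonicNumber_eq_sum_range, powerSum]
  refine .sum fun j hj => ?_
  rw [Finset.mem_range] at hj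
  obtain ⟨f, hf⟩ := exists_pow_pred_eq (p := p) (j := j + 1) (by omega) (by omega)
  have hi := inv_natCast_mem_of_lt (p := p) (k := j + 1) (by omega) (by omega)
  refine ⟨-((((j + 1 : ℕ) : ℚ)⁻¹) ^ m * f),
    neg_mem (mul_mem (pow_mem hi _) (intCast_mem _ _)), ?_⟩
  have hf' : ((j + 1 : ℕ) : ℚ) ^ (p - 1 - m) * ((j + 1 : ℕ) : ℚ) ^ m = 1 + p * f := by
    rw [← pow_add, show p - 1 - m + m = p - 1 by omega]
    exact_mod_cast hf
  have : ((j + 1 : ℕ) : ℚ) ≠ 0 := by positivity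
  rw [inv_pow]
  field_simp
  linear_combination -hf'

theorem exists_zmod_pow_ne_one {e : ℕ} (he : e ≠ 0) (hep : e + 1 < p) :
    ∃ a : ZMod p, a ≠ 0 ∧ a ^ e ≠ 1 := by
  obtain ⟨g, hg⟩ := IsCyclic.exists_ofOrder_eq_natCard (α := (ZMod p)ˣ)
  rw [Nat.card_eq_fintype_card, ZMod.card_units] at hg
  refine ⟨g, g.ne_zero, fun h => ?_⟩
  have h' : g ^ e = 1 := by
    ext
    push_cast
    exact h
  have := Nat.le_of_dvd (Nat.pos_of_ne_zero he) (hg ▸ orderOf_dvd_of_pow_eq_one h')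
  omega

/-- Modulo p^2 a p-th power depends only on the base mod p, so x ↦ a x permutes the terms while
scaling the sum by a^{pe}. Choosing a^e ≠ 1 mod p makes a^{pe} - 1 a unit. -/
theorem sum_zmod_val_pow_eq_zero {e : ℕ} (he : e ≠ 0) (hep : e + 1 < p) :
    ∑ x : ZMod p, (x.val : ZMod (p ^ 2)) ^ (p * e) = 0 := by
  obtain ⟨a, ha0, ha⟩ := exists_zmod_pow_ne_one he hep
  have hmul : ∀ x : ZMod p, ((a * x).val : ZMod (p ^ 2)) ^ (p * e) =
      (a.val : ZMod (p ^ 2)) ^ (p * e) * (x.val : ZMod (p ^ 2)) ^ (p * e) := fun x => by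
    rw [pow_mul, pow_mul, pow_mul, ← mul_pow, ← mul_pow, ZMod.val_mul,
      zmod_natCast_pow_prime_eq (Nat.mod_modEq _ p)]
    push_cast
    rfl
  have hS := Equiv.sum_comp (Equiv.mulLeft₀ a ha0)
    (fun x : ZMod p => (x.val : ZMod (p ^ 2)) ^ (p * e))
  change ∑ x : ZMod p, ((a * x).val : ZMod (p ^ 2)) ^ (p * e) = _ at hS
  simp only [hmul, ← Finset.mul_sum] at hS
  have hu : IsUnit ((a.val : ZMod (p ^ 2)) ^ (p * e) - 1) := by
    have hcast : (a.val : ZMod (p ^ 2)) ^ (p * e) - 1 =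
        (((a.val : ℤ) ^ (p * e) - 1 : ℤ) : ZMod (p ^ 2)) := by push_cast; rfl
    rw [hcast, ZMod.coe_int_isUnit_iff_isCoprime]
    push_cast
    refine IsCoprime.pow_left ?_
    rw [(Nat.prime_iff_prime_int.1 Fact.out).irreducible.coprime_iff_not_dvd,
      ← ZMod.intCast_zmod_eq_zero_iff_dvd]
    push_cast
    rw [ZMod.natCast_zmod_val, pow_mul, ZMod.pow_card]
    exact sub_ne_zero.2 ha
  rw [← hu.mul_right_eq_zero]
  linear_combination hS

theorem powerSum_prime_mul_modEq_zero {e : ℕ} (he : e ≠ 0) (hep : e + 1 < p) :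
    IntegralModEq p 2 (powerSum p (p * e)) 0 := by
  have hp := (Fact.out : p.Prime).pos
  have h := sum_zmod_val_pow_eq_zero he hep
  rw [powerSum_eq_sum_range (mul_ne_zero hp.ne' he)]
  have h1 : ∑ j ∈ Finset.range p, (j : ZMod (p ^ 2)) ^ (p * e) = 0 := by
    rw [← h, Finset.sum_range]
    refine Fintype.sum_equiv (ZMod.finEquiv p).toEquiv _ _ fun i => ?_
    obtain ⟨q, rfl⟩ : ∃ q, p = q + 1 := ⟨p - 1, by omega⟩
    rfl
  have h2 : ((∑ j ∈ Finset.range p, (j : ℤ) ^ (p * e) : ℤ) : ZMod (p ^ 2)) = 0 := by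
    push_cast
    exact h1
  rw [ZMod.intCast_zmod_eq_zero_iff_dvd] at h2
  rw [Nat.cast_pow] at h2
  have := IntegralModEq.intCast_of_dvd h2
  push_cast at this
  exact this

/-- Write j^{p-1} = 1 + pf and e = p - 1 - m. Then j^{-m} ≡ j^e(1 - pf) and j^{pe} ≡ j^e(1 + epf)
mod p^2; eliminating f leaves the sum of j^{pe}, which vanishes. -/
theorem add_one_mul_powerSum_modEq {m : ℕ} (hm : m ≠ 0) (hmp : m + 1 < p) :
    IntegralModEq p 2 ((m + 1) * harmonicNumber (p - 1) m) (m * powerSum p (p - 1 - m)) := by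
  obtain ⟨e, he⟩ : ∃ e, p = m + e + 1 := ⟨p - 1 - m, by omega⟩
  have hee : p - 1 - m = e := by omega
  have hp0 : (p : ℚ) = m + e + 1 := by rw [he]; push_cast; ring
  rw [hee]
  have h1 : IntegralModEq p 2 ((1 + e) * powerSum p e - e * harmonicNumber (p - 1) m)
      (powerSum p (p * e)) := by
    rw [harmonicNumber_eq_sum_range, powerSum, powerSum, Finset.mul_sum, Finset.mul_sum,
      ← Finset.sum_sub_distrib]
    refine .sum fun j hj => ?_
    rw [Finset.mem_range] at hj
    obtain ⟨f, hf⟩ := exists_pow_pred_eq (p := p) (j := j + 1) (by omega) (by omega)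
    obtain ⟨c, hc⟩ := exists_one_add_pow_eq p f e
    have hi := inv_natCast_mem_of_lt (p := p) (k := j + 1) (by omega) (by omega)
    generalize j + 1 = y at *
    have hy : (y : ℚ) ≠ 0 := by
      rintro h
      rw [Nat.cast_eq_zero] at h
      subst h
      have : p - 1 ≠ 0 := by omega
      simp only [Nat.cast_zero, zero_pow this] at hf
      have : (p : ℤ) ∣ 1 := ⟨-f, by linear_combination -hf⟩
      have := Int.le_of_dvd one_pos this
      omega
    have hA : (y : ℚ) ^ e * (y : ℚ) ^ m = 1 + p * f := by
      rw [← pow_add, show e + m = p - 1 by omega]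
      exact_mod_cast hf
    have hB : (y : ℚ) ^ (p * e) = (y : ℚ) ^ e * (1 + e * p * f + p ^ 2 * c) := by
      have hc' : ((1 : ℚ) + p * f) ^ e = 1 + e * p * f + p ^ 2 * c := by exact_mod_cast hc
      rw [← hc', ← hA, ← pow_add, ← pow_mul, ← pow_add]
      congr 1
      rw [he]; ring
    refine ⟨-(((y : ℚ)⁻¹) ^ m * e * f ^ 2 + y ^ e * c), neg_mem (add_mem (mul_mem (mul_mem
      (pow_mem hi _) (natCast_mem _ _)) (pow_mem (intCast_mem _ _) _)) (mul_mem (pow_mem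
      (natCast_mem _ _) _) (intCast_mem _ _))), ?_⟩
    rw [hB]
    rw [inv_pow]
    field_simp
    linear_combination (e : ℚ) * (1 - p * f) * hA
  have h2 := h1.trans (powerSum_prime_mul_modEq_zero (by omega) (by omega))
  -- With 1 + e = p - m, the extra multiples of p in both coefficients disappear because each sum is
  -- already 0 mod p.
  have h3 := (harmonicNumber_modEq_zero hm hmp).prime_mul
  have h4 := (powerSum_modEq_zero (p := p) (e := e) (by omega) (by omega)).prime_mul
  refine IntegralModEq.trans (.of_eq ?_) (((h2.add h3).sub h4).trans
    (.of_eq (b := 0) (by ring)) |>.add (.refl (m * powerSum p e)) |>.trans (.of_eq (by ring)))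
  rw [hp0]
  ring

theorem inv_prime_sub_pow_modEq {x : ℚ} (hx : x ≠ 0) (hy : (p : ℚ) - x ≠ 0)
    (hxi : x⁻¹ ∈ padicIntegral p) (hyi : ((p : ℚ) - x)⁻¹ ∈ padicIntegral p) (m : ℕ) :
    IntegralModEq p 2 (1 / ((p : ℚ) - x) ^ m)
      ((-1) ^ m * (1 / x ^ m + m * p * (1 / x ^ (m + 1)))) := by
  induction m with
  | zero => exact .of_eq (by simp)
  | succ m ih =>
    obtain ⟨c, hc, ih⟩ := ih
    refine ⟨((p : ℚ) - x)⁻¹ * c + (-1) ^ m * (m + 1) * (x⁻¹) ^ (m + 2) * ((p : ℚ) - x)⁻¹, ?_, ?_⟩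
    · refine add_mem (mul_mem hyi hc) (mul_mem (mul_mem (mul_mem ?_ ?_) (pow_mem hxi _)) hyi)
      · exact pow_mem (neg_mem (one_mem _)) _
      · exact_mod_cast natCast_mem (padicIntegral p) (m + 1)
    · have e : 1 / ((p : ℚ) - x) ^ (m + 1) = ((p : ℚ) - x)⁻¹ *
          ((-1) ^ m * (1 / x ^ m + m * p * (1 / x ^ (m + 1))) + p ^ 2 * c) := by
        rw [← ih, pow_succ]
        field_simp
        ring
      rw [e, pow_succ (-1 : ℚ) m, inv_pow]
      push_cast
      field_simp
      ring

end PowerSums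

/-! ### Pairing j with p - j -/

section Reindexing

variable (n : ℕ) (f : ℕ → ℚ)

theorem sum_range_two_mul_eq_sum_add_reflect :
    ∑ j ∈ Finset.range (2 * n), f (j + 1) =
      ∑ j ∈ Finset.range n, (f (j + 1) + f (2 * n + 1 - (j + 1))) := by
  rw [two_mul, Finset.sum_range_add, Finset.sum_add_distrib]
  congr 1
  rw [← Finset.sum_range_reflect]
  refine Finset.sum_congr rfl fun j hj => ?_
  rw [Finset.mem_range] at hj
  congr 1
  omega

/-- The odd indices are the reflections 2n + 1 - 2i of the even ones. -/
theorem sum_range_two_mul_eq_sum_even_add_odd :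
    ∑ j ∈ Finset.range (2 * n), f (j + 1) =
      ∑ j ∈ Finset.range n, (f (2 * (j + 1)) + f (2 * n + 1 - 2 * (j + 1))) := by
  have h : ∑ j ∈ Finset.range (2 * n), f (j + 1) =
      ∑ j ∈ Finset.range n, (f (2 * (j + 1)) + f (2 * j + 1)) := by
    induction n with
    | zero => simp
    | succ n ih =>
      rw [Finset.sum_range_succ, ← ih, show 2 * (n + 1) = 2 * n + 1 + 1 by ring,
        Finset.sum_range_succ, Finset.sum_range_succ]
      ring
  rw [h, Finset.sum_add_distrib, Finset.sum_add_distrib]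
  congr 1
  rw [← Finset.sum_range_reflect]
  refine Finset.sum_congr rfl fun j hj => ?_
  rw [Finset.mem_range] at hj
  congr 1
  omega

end Reindexing

/-! ### Assembling the supercongruence -/

section Supercongruence

variable {p : ℕ} [Fact p.Prime]

theorem one_div_prime_sub_pow_modEq {k : ℕ} (h0 : 0 < k) (hk : k < p) (m : ℕ) :
    IntegralModEq p 2 (1 / ((p - k : ℕ) : ℚ) ^ m)
      ((-1) ^ m * (1 / (k : ℚ) ^ m + m * p * (1 / (k : ℚ) ^ (m + 1)))) := by
  have hc : ((p - k : ℕ) : ℚ) = p - k := Nat.cast_sub hk.le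
  have h1 : ((p - k : ℕ) : ℚ) ≠ 0 := by
    rw [Nat.cast_ne_zero]; omega
  have h2 := inv_natCast_mem_of_lt (p := p) (k := p - k) (by omega) (by omega)
  rw [hc] at h1 h2 ⊢
  exact inv_prime_sub_pow_modEq (Nat.cast_ne_zero.2 h0.ne') h1 (inv_natCast_mem_of_lt h0 hk) h2 m

theorem harmonicNumber_modEq_half {n : ℕ} (hp : p = 2 * n + 1) (m : ℕ) :
    IntegralModEq p 2 (harmonicNumber (p - 1) m)
      (harmonicNumber n m +
        (-1) ^ m * (harmonicNumber n m + m * p * harmonicNumber n (m + 1))) := by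
  have h : harmonicNumber (p - 1) m = ∑ j ∈ Finset.range n,
      (1 / ((j + 1 : ℕ) : ℚ) ^ m + 1 / ((p - (j + 1) : ℕ) : ℚ) ^ m) := by
    rw [harmonicNumber_eq_sum_range, hp, Nat.add_sub_cancel]
    exact sum_range_two_mul_eq_sum_add_reflect n fun j => 1 / (j : ℚ) ^ m
  rw [h, harmonicNumber_eq_sum_range, harmonicNumber_eq_sum_range, Finset.mul_sum,
    ← Finset.sum_add_distrib, Finset.mul_sum, ← Finset.sum_add_distrib]
  refine .sum fun j hj => ?_
  rw [Finset.mem_range] at hj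
  exact (IntegralModEq.refl _).add (one_div_prime_sub_pow_modEq (by omega) (by omega) m)

/-- The even/odd split gives a second relation with p/2 in place of p; for even m, subtracting the
two eliminates H_n^{(m)}. -/
theorem two_pow_mul_harmonicNumber_modEq_half {n : ℕ} (hp : p = 2 * n + 1) (m : ℕ) :
    IntegralModEq p 2 (2 ^ m * harmonicNumber (p - 1) m)
      (harmonicNumber n m +
        (-1) ^ m * (harmonicNumber n m + m * p / 2 * harmonicNumber n (m + 1))) := by
  have h : harmonicNumber (p - 1) m = ∑ j ∈ Finset.range n,
      (1 / ((2 * (j + 1) : ℕ) : ℚ) ^ m + 1 / ((p - 2 * (j + 1) : ℕ) : ℚ) ^ m) := by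
    rw [harmonicNumber_eq_sum_range, hp, Nat.add_sub_cancel]
    exact sum_range_two_mul_eq_sum_even_add_odd n fun j => 1 / (j : ℚ) ^ m
  rw [h, harmonicNumber_eq_sum_range, harmonicNumber_eq_sum_range, Finset.mul_sum,
    Finset.mul_sum, ← Finset.sum_add_distrib, Finset.mul_sum, ← Finset.sum_add_distrib]
  refine .sum fun j hj => ?_
  rw [Finset.mem_range] at hj
  have h1 := ((IntegralModEq.refl (1 / ((2 * (j + 1) : ℕ) : ℚ) ^ m)).add
    (one_div_prime_sub_pow_modEq (p := p) (k := 2 * (j + 1)) (by omega) (by omega) m)).mul_left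
      (c := 2 ^ m) (by exact_mod_cast natCast_mem (padicIntegral p) (2 ^ m))
  refine h1.trans (.of_eq ?_)
  have : ((j + 1 : ℕ) : ℚ) ≠ 0 := by positivity
  rw [Nat.cast_mul, mul_pow, mul_pow]
  field_simp
  push_cast
  ring

theorem onesHarmonicSum_modEq_zero {m : ℕ} (hm : m ≠ 0) (hmp : m + 1 < p) :
    IntegralModEq p 1 (onesHarmonicSum (p - 1) m) 0 := by
  obtain ⟨m, rfl⟩ := Nat.exists_eq_succ_of_ne_zero hm
  have hi := inv_natCast_mem_of_lt (p := p) (k := m + 1) (by omega) (by omega)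
  have h : IntegralModEq p 1 (∑ i ∈ Finset.range (m + 1),
      harmonicNumber (p - 1) (i + 1) * onesHarmonicSum (p - 1) (m - i))
      (∑ i ∈ Finset.range (m + 1), 0 * onesHarmonicSum (p - 1) (m - i)) := by
    refine .sum fun i hi => ?_
    rw [Finset.mem_range] at hi
    exact .mul (zero_mem _) (onesHarmonicSum_mem _ (by omega))
      (harmonicNumber_modEq_zero (by omega) (by omega)) (.refl _)
  rw [← succ_mul_onesHarmonicSum_succ] at h
  have h' := h.mul_left hi
  push_cast at h'
  simp only [zero_mul, Finset.sum_const_zero, mul_zero] at h'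
  rwa [inv_mul_cancel_left₀ (by positivity)] at h'

/-- In Newton's identity every term but the last is a product of two multiples of p. -/
theorem onesHarmonicSum_modEq {m : ℕ} (hmp : m + 2 < p) :
    IntegralModEq p 2 (onesHarmonicSum (p - 1) (m + 1))
      (harmonicNumber (p - 1) (m + 1) / ((m : ℚ) + 1)) := by
  have hi := inv_natCast_mem_of_lt (p := p) (k := m + 1) (by omega) (by omega)
  have h : IntegralModEq p 2 (∑ i ∈ Finset.range m,
      harmonicNumber (p - 1) (i + 1) * onesHarmonicSum (p - 1) (m - i))
      (∑ i ∈ Finset.range m, 0) := by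
    refine .sum fun i hi => ?_
    rw [Finset.mem_range] at hi
    exact (harmonicNumber_modEq_zero (by omega) (by omega)).mul_zero_zero
      (onesHarmonicSum_modEq_zero (by omega) (by omega))
  have h' := ((h.add (.refl (harmonicNumber (p - 1) (m + 1) *
    onesHarmonicSum (p - 1) (m - m)))).mul_left hi)
  rw [← Finset.sum_range_succ (fun i => harmonicNumber (p - 1) (i + 1) *
    onesHarmonicSum (p - 1) (m - i)), ← succ_mul_onesHarmonicSum_succ] at h'
  push_cast at h'
  rw [inv_mul_cancel_left₀ (by positivity), Nat.sub_self, onesHarmonicSum_zero_right,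
    Finset.sum_const_zero] at h'
  exact h'.trans (.of_eq (by ring))

theorem risingSumDiff_modEq (a r : ℕ) (ha : a + 1 < p) (hr : r + 1 < p) :
    IntegralModEq p 2 (risingSumDiff (p - 1) r ((a : ℚ) + 1))
      ((-1) ^ r * (p * (1 / ((a + 1 : ℕ) : ℚ) ^ (r + 2)) - 1 / ((a + 1 : ℕ) : ℚ) ^ (r + 1))) := by
  have hi := inv_natCast_mem_of_lt (p := p) (k := a + 1) (by omega) (by omega)
  have ha0 : ((a + 1 : ℕ) : ℚ) ≠ 0 := by positivity
  have hC := risingFactorial_div_factorial_modEq (p := p) a ha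
  have hcast : (a : ℚ) + 1 = ((a + 1 : ℕ) : ℚ) := by push_cast; rfl
  rw [hcast] at hC ⊢
  generalize ((a + 1 : ℕ) : ℚ) = y at *
  induction r with
  | zero =>
    have h := (hC.sub (.refl 1)).mul_left hi
    rw [← mul_risingSumDiff_zero, inv_mul_cancel_left₀ ha0] at h
    refine h.trans (.of_eq ?_)
    field_simp
    ring
  | succ r ih =>
    have hC0 : IntegralModEq p 1
        (risingFactorial (y + 1) (p - 1) / (p - 1).factorial) 0 :=
      hC.of_two.trans (by rw [div_eq_mul_inv]; exact .prime_mul_zero hi)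
    -- The right side of the depth recursion dies mod p^2, leaving division by -y.
    have h0 := hC0.mul_zero_zero (onesHarmonicSum_modEq_zero (m := r + 1) (by omega) hr)
    rw [← mul_risingSumDiff_succ] at h0
    have h := (h0.sub (ih (by omega))).mul_left hi
    refine (IntegralModEq.of_eq ?_).trans (h.trans (.of_eq ?_))
    · field_simp
      ring
    · rw [pow_succ (-1 : ℚ) r]
      field_simp
      ring

theorem risingSum_modEq {n : ℕ} (hn : n < p) {r : ℕ} (hr : r + 2 < p) :
    IntegralModEq p 2 (risingSum (p - 1) r ((n : ℚ) + 1))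
      (harmonicNumber (p - 1) (r + 1) / ((r : ℚ) + 1) +
        (-1) ^ r * (p * harmonicNumber n (r + 2) - harmonicNumber n (r + 1))) := by
  rw [risingSum_natCast]
  refine (onesHarmonicSum_modEq hr).add ?_
  rw [harmonicNumber_eq_sum_range, harmonicNumber_eq_sum_range, Finset.mul_sum,
    ← Finset.sum_sub_distrib, Finset.mul_sum]
  refine .sum fun a ha => ?_
  rw [Finset.mem_range] at ha
  exact risingSumDiff_modEq a r (by omega) (by omega)

theorem sum_centralBinom_modEq {n : ℕ} (hp : p = 2 * n + 1) {r : ℕ} (hr : r + 2 < p) :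
    IntegralModEq p 2
      (∑ k ∈ Finset.Icc 1 (p - 1),
        ((2 * k).choose k : ℚ) / ((k : ℚ) * 4 ^ k) * onesHarmonicSum k r)
      (1 / 2 * (-harmonicNumber n (r + 1) + (harmonicNumber (p - 1) (r + 1) / ((r : ℚ) + 1) +
        (-1) ^ r * (p * harmonicNumber n (r + 2) - harmonicNumber n (r + 1))))) := by
  have h2 : (1 / 2 : ℚ) ∈ padicIntegral p := by
    simpa using inv_natCast_mem_of_lt (p := p) (k := 2) (by omega) (by omega)
  have h := (two_mul_sum_centralBinom_modEq hp r).trans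
    ((IntegralModEq.of_eq (risingSum_neg (p - 1) n r (by omega))).add
      (risingSum_modEq (by omega) hr))
  exact (IntegralModEq.of_eq (by ring)).trans (h.mul_left h2)

theorem sum_centralBinom_modEq_of_even {n : ℕ} (hp : p = 2 * n + 1) {r : ℕ} (hr : r + 2 < p)
    (he : Even r) :
    IntegralModEq p 2
      (∑ k ∈ Finset.Icc 1 (p - 1),
        ((2 * k).choose k : ℚ) / ((k : ℚ) * 4 ^ k) * onesHarmonicSum k r)
      (-harmonicNumber n (r + 1)) := by
  have h2 : (1 / 2 : ℚ) ∈ padicIntegral p := by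
    simpa using inv_natCast_mem_of_lt (p := p) (k := 2) (by omega) (by omega)
  have hi := inv_natCast_mem_of_lt (p := p) (k := r + 1) (by omega) (by omega)
  have h := sum_centralBinom_modEq hp hr
  -- For odd r + 1 reflection gives H_{p-1}^{(r+1)} ≡ -(r+1) p H_n^{(r+2)}, cancelling both
  -- correction terms.
  have hX := (harmonicNumber_modEq_half hp (r + 1)).mul_left (mul_mem h2 hi)
  rw [he.add_one.neg_one_pow] at hX
  rw [he.neg_one_pow] at h
  have h3 := (h.add hX).sub (.refl (1 / 2 * ((r + 1 : ℕ) : ℚ)⁻¹ *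
    harmonicNumber (p - 1) (r + 1)))
  refine ((IntegralModEq.of_eq ?_).trans h3).trans (.of_eq ?_)
  · ring
  · push_cast
    field_simp
    ring

theorem sum_centralBinom_modEq_of_odd {n : ℕ} (hp : p = 2 * n + 1) {r : ℕ} (hr : r + 3 < p)
    (ho : Odd r) :
    IntegralModEq p 2
      (∑ k ∈ Finset.Icc 1 (p - 1),
        ((2 * k).choose k : ℚ) / ((k : ℚ) * 4 ^ k) * onesHarmonicSum k r)
      ((2 ^ (r + 2) - 1) / (2 * ((r : ℚ) + 2)) * ((p : ℚ) * bernoulli (p - r - 2))) := by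
  have h2 : (1 / 2 : ℚ) ∈ padicIntegral p := by
    simpa using inv_natCast_mem_of_lt (p := p) (k := 2) (by omega) (by omega)
  have hi := inv_natCast_mem_of_lt (p := p) (k := r + 1) (by omega) (by omega)
  have hi' := inv_natCast_mem_of_lt (p := p) (k := r + 2) (by omega) (by omega)
  have h2m : (2 : ℚ) ^ (r + 2) - 1 ∈ padicIntegral p :=
    sub_mem (by exact_mod_cast natCast_mem (padicIntegral p) (2 ^ (r + 2))) (one_mem _)
  have h := sum_centralBinom_modEq (r := r) hp (by omega)
  rw [ho.neg_one_pow] at h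
  have hX := harmonicNumber_modEq_half hp (r + 1)
  have hY := two_pow_mul_harmonicNumber_modEq_half hp (r + 1)
  rw [ho.add_one.neg_one_pow] at hX hY
  -- This expresses p H_n^{(r+2)} / 2 as (1 - 2^{r+1})/(r+1) · H_{p-1}^{(r+1)}, so the whole sum
  -- becomes (2^{r+2} - 1)/(2(r+1)) · H_{p-1}^{(r+1)}.
  have hZ := (hX.sub hY).mul_left hi
  have hB := (add_one_mul_powerSum_modEq (p := p) (m := r + 1) (by omega) (by omega)).mul_left
    (mul_mem hi hi')
  have hP := (powerSum_modEq_bernoulli (p := p) (e := p - 1 - (r + 1)) (by omega)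
    (by omega)).mul_left hi'
  rw [show p - 1 - (r + 1) = p - r - 2 by omega] at hB hP
  have hB' : IntegralModEq p 2 (((r + 1 : ℕ) : ℚ)⁻¹ * harmonicNumber (p - 1) (r + 1))
      (((r + 2 : ℕ) : ℚ)⁻¹ * powerSum p (p - r - 2)) := by
    refine ((IntegralModEq.of_eq ?_).trans hB).trans (.of_eq ?_)
    · push_cast
      field_simp
      ring
    · push_cast
      field_simp
  have hXB := (hB'.trans hP).mul_left (mul_mem h2 h2m)
  have h3 := ((h.add hZ).add hXB).sub (.refl (1 / 2 * ((r + 1 : ℕ) : ℚ)⁻¹ *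
    harmonicNumber (p - 1) (r + 1)))
  refine ((IntegralModEq.of_eq ?_).trans h3).trans (.of_eq ?_)
  · push_cast
    field_simp
    ring
  · push_cast
    field_simp
    ring

end Supercongruence

theorem mainTheorem3 (p : ℕ) [Fact p.Prime] (r : ℕ) (hpr : r + 3 < p) :
    (Even r →
      PadicModEq p 2
        (∑ k ∈ Finset.Icc 1 (p - 1),
          ((2 * k).choose k : ℚ) / ((k : ℚ) * 4 ^ k) *
            multipleHarmonicSum k (fun _ : Fin r => 1))
        (-harmonicNumber ((p - 1) / 2) (r + 1))) ∧
    (Odd r →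
      PadicModEq p 2
        (∑ k ∈ Finset.Icc 1 (p - 1),
          ((2 * k).choose k : ℚ) / ((k : ℚ) * 4 ^ k) *
            multipleHarmonicSum k (fun _ : Fin r => 1))
        ((2 ^ (r + 2) - 1) / (2 * ((r : ℚ) + 2)) * ((p : ℚ) * bernoulli (p - r - 2)))) := by
  have hp : p = 2 * ((p - 1) / 2) + 1 := by
    have := (Fact.out : p.Prime).eq_two_or_odd
    omega
  exact ⟨fun he => (sum_centralBinom_modEq_of_even hp (by omega) he).padicModEq,
    fun ho => (sum_centralBinom_modEq_of_odd hp hpr ho).padicModEq⟩
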